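/- Fix a nonstandard extension in Robinson's sense, realised as an ultrapower: let $U$ be a countably incomplete ultrafilter on a set $I$ and, for every set $X$, let ${}^*X = X^I/U$, with standard sets, functions and operations ($\partial^\alpha$, $\int$, $\star$) extended to ${}^*$ as usual. Let $d\in\mathbb N$. For $x,y\in{}^*\mathbb R^d$ (or ${}^*\mathbb R$) write $x\approx y$ if $|x-y|<\varepsilon$ for every real $\varepsilon>0$, call $x$ nearstandard if $x\approx a$ for some standard $a$, and infinite if $|x|$ is not bounded by any real number. Write $C^\infty=C^\infty(\mathbb R^d)$ for the smooth functions $\mathbb R^d\to\mathbb R$ and $C^\infty_c$ for those with compact support. An internal function $f:{}^*\mathbb R^d\to{}^*\mathbb R$ is S-compactly supported if there is $R\in\mathbb R$ with $f(x)=0$ for all $x\in{}^*\mathbb R^d$ with $|x|\ge R$. Let $\mathcal T$ be the set of all $\varphi\in{}^*(C^\infty)$ for which there is a standard $g\in C^\infty_c$ such that $\partial^\alpha\varphi(x)\approx\partial^\alpha g(x)$ for all nearstandard $x\in{}^*\mathbb R^d$ and all $\alpha\in\mathbb N^d$, and $\varphi(x)=g(x)$ for all infinite $x\in{}^*\mathbb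 R^d$. Let $$D'=\Big\{f\in{}^*(C^\infty):\ \int_{{}^*\mathbb R^d} f\varphi \text{ is nearstandard for all }\varphi\in\mathcal T\Big\},$$ and write $f\approx_{D'}g$ if $\int f\varphi\approx\int g\varphi$ for all $\varphi\in\mathcal T$. Let $P(\partial)=\sum_{|\alpha|\le m}c_\alpha\partial^\alpha$ with $c_\alpha\in\mathbb R$. A (nonstandard) delta function is a $\delta\in{}^*(C^\infty)$ with $\int\varphi\,\delta\approx\varphi(0)$ for all $\varphi\in\mathcal T$. A (nonstandard) fundamental solution for $P(\partial)$ is an $E\in{}^*(C^\infty)$ such that $P(\partial)E$ is a delta function. A weak solution of $P(\partial)u=f$ is a $u\in{}^*(C^\infty)$ with $P(\partial)u\approx_{D'}f$. **Corollary.** If $E$ is a fundamental solution for $P(\partial)$ and $f\in D'$ is S-compactly supported, then $E\star f$, where $(E\star f)(x)=\int_{{}^*\mathbb R^d}E(x-y)f(y)\,dy$, is a weak solution of $P(\partial)u=f$; that is, $E\star f\in{}^*(C^\infty)$ and $P(\partial)(E\star f)\approx_{D'}f$. -/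

import Mathlib

open Filter MeasureTheory
open scoped ContDiff

namespace NSDist

universe u v w

variable {ι : Type u}

/-! ### The nonstandard extension: ultrapowers

For an ultrafilter `U` on an index set, `Star U X` is the nonstandard extension `*X` of a set `X`.
Maps `X → Y` extend by `Germ.map`, maps of two variables by `Germ.map₂`, and relations by
`Germ.LiftPred` and `Germ.LiftRel`. The extension is a proper one exactly when `U` is countably
incomplete. -/

/-- The nonstandard extension `*X` of `X`. -/
abbrev Star (U : Ultrafilter ι) (X : Type v) : Type (max u v) := Germ (U : Filter ι) X

/-- The canonical embedding `X → *X`. For a function `f : X → Y`, regarded as an element of the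
set of all functions, `std U f` is the internal function `*f`. -/
def std (U : Ultrafilter ι) {X : Type v} (x : X) : Star U X := Germ.const x

variable {U : Ultrafilter ι}

/-- The extension of the norm, `*V → *ℝ`. -/
noncomputable def starNorm {V : Type v} [NormedAddCommGroup V] (x : Star U V) : Star U ℝ :=
  Germ.map (fun y : V => ‖y‖) x

/-- `x ≈ 0`: the norm of `x` is smaller than every standard positive real. -/
def Infinitesimal {V : Type v} [NormedAddCommGroup V] (x : Star U V) : Prop :=
  ∀ ε : ℝ, 0 < ε → starNorm x < std U ε

/-- `x ≈ y`: the difference is infinitesimal. -/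
def Near {V : Type v} [NormedAddCommGroup V] (x y : Star U V) : Prop :=
  Infinitesimal (x - y)

/-- `x` is infinitely close to some standard point (for `V = ℝ^d`: `x` is finite). -/
def Nearstandard {V : Type v} [NormedAddCommGroup V] (x : Star U V) : Prop :=
  ∃ y : V, Near x (std U y)

/-- `x` is infinite: its norm is not bounded by any standard real. -/
def IsInfinite {V : Type v} [NormedAddCommGroup V] (x : Star U V) : Prop :=
  ¬ ∃ R : ℝ, starNorm x ≤ std U R

/-! ### Standard operations on functions on `ℝ^d` -/

/-- `ℝ^d` with its Euclidean norm and Lebesgue measure. -/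
abbrev Rn (d : ℕ) : Type := EuclideanSpace ℝ (Fin d)

variable {d : ℕ}

/-- The partial derivative `∂_j f`. -/
noncomputable def partialDeriv (j : Fin d) (f : Rn d → ℝ) : Rn d → ℝ :=
  fun x => fderiv ℝ f x (EuclideanSpace.single j 1)

/-- `∂^α f = ∂_1^{α_1} ⋯ ∂_d^{α_d} f`. -/
noncomputable def multiDeriv (α : Fin d →₀ ℕ) (f : Rn d → ℝ) : Rn d → ℝ :=
  (List.finRange d).foldr (fun j g => (partialDeriv j)^[α j] g) f

/-- `P(∂) f = ∑_α c_α ∂^α f` for a real polynomial `P = ∑_α c_α X^α` in `d` variables. -/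
noncomputable def polyDiff (P : MvPolynomial (Fin d) ℝ) (f : Rn d → ℝ) : Rn d → ℝ :=
  fun x => ∑ α ∈ P.support, P.coeff α * multiDeriv α f x

/-- The convolution `(f ⋆ g)(x) = ∫ f(x - y) g(y) dy`. -/
noncomputable def conv (f g : Rn d → ℝ) : Rn d → ℝ :=
  fun x => ∫ y, f (x - y) * g y

/-! ### Internal functions `*ℝ^d → *ℝ` -/

/-- Internal functions `*ℝ^d → *ℝ`. -/
abbrev StarFun (U : Ultrafilter ι) (d : ℕ) : Type u := Star U (Rn d → ℝ)

/-- The value `f(x)` of an internal function at a point of `*ℝ^d`. -/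
def starEval (f : StarFun U d) (x : Star U (Rn d)) : Star U ℝ :=
  Germ.map₂ (fun (g : Rn d → ℝ) (y : Rn d) => g y) f x

/-- The integral over `*ℝ^d` of an internal function. -/
noncomputable def starIntegral (f : StarFun U d) : Star U ℝ :=
  Germ.map (fun g : Rn d → ℝ => ∫ x, g x) f

/-- `∂^α` on internal functions, for a standard multi-index `α`. -/
noncomputable def starMultiDeriv (α : Fin d →₀ ℕ) (f : StarFun U d) : StarFun U d :=
  Germ.map (multiDeriv α) f

/-- `P(∂)` on internal functions. -/
noncomputable def starPolyDiff (P : MvPolynomial (Fin d) ℝ) (f : StarFun U d) : StarFun U d :=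
  Germ.map (polyDiff P) f

/-- The convolution of internal functions. -/
noncomputable def starConv (f g : StarFun U d) : StarFun U d :=
  Germ.map₂ conv f g

/-- `f ∈ *(C^∞(ℝ^d))`. -/
def IsStarSmooth (f : StarFun U d) : Prop :=
  Germ.LiftPred (fun g : Rn d → ℝ => ContDiff ℝ ∞ g) f

/-- `f` is S-compactly supported: it vanishes outside a ball of standard radius. -/
def SCompactlySupported (f : StarFun U d) : Prop :=
  ∃ R : ℝ, ∀ x : Star U (Rn d), std U R ≤ starNorm x → starEval f x = 0

/-- `f ≈_{C^∞} g`, for `f, g ∈ *(C^∞)`. -/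
def ApproxSmooth (f g : StarFun U d) : Prop :=
  IsStarSmooth f ∧ IsStarSmooth g ∧
    ∀ (α : Fin d →₀ ℕ) (x : Star U (Rn d)), Nearstandard x →
      Near (starEval (starMultiDeriv α f) x) (starEval (starMultiDeriv α g) x)

/-- `f ≈_{C^∞_c} g`, for `f, g ∈ *(C^∞)`. -/
def ApproxSmoothCompact (f g : StarFun U d) : Prop :=
  ApproxSmooth f g ∧ ∀ x : Star U (Rn d), IsInfinite x → starEval f x = starEval g x

/-- `φ` is `≈_{C^∞_c}` to some standard function in `C^∞_c(ℝ^d)`. -/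
def NearTestFunction (φ : StarFun U d) : Prop :=
  ∃ g : Rn d → ℝ, ContDiff ℝ ∞ g ∧ HasCompactSupport g ∧ ApproxSmoothCompact φ (std U g)

/-! ### The space `D'`, delta functions, fundamental solutions, weak solutions -/

/-- `f ∈ D'`. -/
def MemD' (f : StarFun U d) : Prop :=
  IsStarSmooth f ∧ ∀ φ : StarFun U d, NearTestFunction φ → Nearstandard (starIntegral (f * φ))

/-- `f ≈_{D'} g`. -/
def ApproxD' (f g : StarFun U d) : Prop :=
  ∀ φ : StarFun U d, NearTestFunction φ → Near (starIntegral (f * φ)) (starIntegral (g * φ))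

/-- `δ` is a (nonstandard) delta function. -/
def IsDeltaFunction (δ : StarFun U d) : Prop :=
  IsStarSmooth δ ∧ ∀ φ : StarFun U d, NearTestFunction φ →
    Near (starIntegral (φ * δ)) (starEval φ (std U 0))

/-- `E` is a (nonstandard) fundamental solution for `P(∂)`. -/
def IsFundamentalSolution (P : MvPolynomial (Fin d) ℝ) (E : StarFun U d) : Prop :=
  IsStarSmooth E ∧ IsDeltaFunction (starPolyDiff P E)

/-- `u` is a weak solution of `P(∂) u = f`. -/
def IsWeakSolution (P : MvPolynomial (Fin d) ℝ) (f u : StarFun U d) : Prop :=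
  IsStarSmooth u ∧ ApproxD' (starPolyDiff P u) f

end NSDist

/-! Put D = P(∂)E. Derivatives of E ⋆ f fall on E, so P(∂)(E ⋆ f) = D ⋆ f, and Fubini turns ∫ (D ⋆
f) φ into ∫ ψ D with ψ(z) = ∫ f(y) φ(z + y) dy. If ψ is again a test function, the delta property
gives ∫ ψ D ≈ ψ(0) = ∫ f φ, as required.

The real content is that ψ is a test function (`nearTestFunction_conv_neg`). Test functions are
exactly the internal smooth functions that vanish off one standard ball and have every standard
derivative bounded by a standard constant (`nearTestFunction_coe`,
`NearTestFunction.exists_bounds`). The derivatives of ψ are pairings of f with translates of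
derivatives of φ, and `MemD'.exists_bound` bounds such pairings: on a fixed ball, f acts as a
distribution of finite order. Countable incompleteness enters through `exists_infinite_index`, used
for this estimate and for the common support radius. -/

namespace NSDist

open Topology

/-! ### Coordinate calculus: gradients, multi-index derivatives, Taylor bounds. -/

section Calculus

variable {d : ℕ}

/-- The linear form with the given coordinates. -/
noncomputable def coordForm (c : Fin d → ℝ) : Rn d →L[ℝ] ℝ :=
  ∑ j, c j • (EuclideanSpace.proj j : Rn d →L[ℝ] ℝ)

theorem coordForm_apply (c : Fin d → ℝ) (v : Rn d) : coordForm c v = ∑ j, c j * v j := by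
  simp [coordForm]

theorem coordForm_single (c : Fin d → ℝ) (j : Fin d) :
    coordForm c (EuclideanSpace.single j 1) = c j := by
  simp [coordForm_apply]

theorem norm_coordForm_le (c : Fin d → ℝ) : ‖coordForm c‖ ≤ ∑ j, |c j| := by
  refine ContinuousLinearMap.opNorm_le_bound _ (by positivity) fun v => ?_
  rw [coordForm_apply, Finset.sum_mul]
  refine (norm_sum_le _ _).trans (Finset.sum_le_sum fun j _ => ?_)
  rw [norm_mul, Real.norm_eq_abs]
  gcongr
  exact PiLp.norm_apply_le v j

theorem coordForm_sub (c e : Fin d → ℝ) :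
    coordForm c - coordForm e = coordForm (fun j => c j - e j) := by
  ext v
  simp [coordForm_apply, sub_mul]

theorem eq_coordForm (L : Rn d →L[ℝ] ℝ) :
    L = coordForm fun j => L (EuclideanSpace.single j 1) := by
  ext v
  have hv : v = ∑ j, v j • EuclideanSpace.single j (1 : ℝ) := by
    ext k
    simp [Finset.sum_apply, Pi.single_apply]
  conv_lhs => rw [hv]
  simp [coordForm_apply, mul_comm]

theorem fderiv_eq_coordForm (f : Rn d → ℝ) (x : Rn d) :
    fderiv ℝ f x = coordForm fun j => partialDeriv j f x :=
  eq_coordForm _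

theorem partialDeriv_eq_of_hasFDerivAt {f : Rn d → ℝ} {c : Rn d → Fin d → ℝ}
    (h : ∀ x, HasFDerivAt f (coordForm (c x)) x) (j : Fin d) :
    partialDeriv j f = fun x => c x j := by
  funext x
  rw [partialDeriv, (h x).fderiv, coordForm_single]

theorem contDiff_coordForm {n : ℕ∞ω} {c : Rn d → Fin d → ℝ}
    (h : ∀ j, ContDiff ℝ n fun x => c x j) : ContDiff ℝ n fun x => coordForm (c x) := by
  unfold coordForm
  exact ContDiff.sum fun j _ => (h j).smul contDiff_const

/-- A family of functions that is closed under taking partial derivatives consists of smooth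
functions. -/
theorem contDiff_of_closed_family {A : Type*} (u : A → Rn d → ℝ) (s : Fin d → A → A)
    (h : ∀ a x, HasFDerivAt (u a) (coordForm fun j => u (s j a) x) x) (a : A) :
    ContDiff ℝ ∞ (u a) := by
  rw [contDiff_infty]
  intro n
  -- The index must vary, since each derivative belongs to another member of the family.
  induction n generalizing a with
  | zero =>
    exact contDiff_zero.2 (continuous_iff_continuousAt.2 fun x => (h a x).continuousAt)
  | succ n ih =>
    exact contDiff_succ_iff_hasFDerivAt.2 ⟨_, contDiff_coordForm fun j => ih (s j a), h a⟩

theorem contDiff_partialDeriv {f : Rn d → ℝ} (hf : ContDiff ℝ ∞ f) (j : Fin d) :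
    ContDiff ℝ ∞ (partialDeriv j f) :=
  (hf.fderiv_right (m := ∞) (by simp)).clm_apply contDiff_const

theorem differentiable_of_smooth {f : Rn d → ℝ} (hf : ContDiff ℝ ∞ f) : Differentiable ℝ f :=
  hf.differentiable (by simp)

theorem partialDeriv_comm {f : Rn d → ℝ} (hf : ContDiff ℝ ∞ f) (j k : Fin d) :
    partialDeriv j (partialDeriv k f) = partialDeriv k (partialDeriv j f) := by
  funext x
  have hd : Differentiable ℝ (fderiv ℝ f) :=
    (hf.fderiv_right (m := ∞) (by simp)).differentiable (by simp)
  have key : ∀ j k : Fin d, partialDeriv j (partialDeriv k f) x =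
      fderiv ℝ (fderiv ℝ f) x (EuclideanSpace.single j 1) (EuclideanSpace.single k 1) := by
    intro j k
    unfold partialDeriv
    rw [fderiv_clm_apply (hd x) (differentiableAt_const _)]
    simp
  rw [key, key]
  exact second_derivative_symmetric (fun y => (differentiable_of_smooth hf y).hasFDerivAt)
    (hd x).hasFDerivAt _ _

/-- Relations preserved by the partial derivatives are preserved by `multiDeriv α`. -/
theorem multiDeriv_rel {C : (Rn d → ℝ) → (Rn d → ℝ) → Prop}
    (h : ∀ j f g, C f g → C (partialDeriv j f) (partialDeriv j g)) (α : Fin d →₀ ℕ)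
    {f g : Rn d → ℝ} (hfg : C f g) : C (multiDeriv α f) (multiDeriv α g) := by
  unfold multiDeriv
  induction List.finRange d with
  | nil => exact hfg
  | cons j l ih =>
    simp only [List.foldr_cons]
    induction α j with
    | zero => exact ih
    | succ n ihn =>
      simp only [Function.iterate_succ_apply']
      exact h _ _ _ ihn

theorem contDiff_multiDeriv (α : Fin d →₀ ℕ) {f : Rn d → ℝ} (hf : ContDiff ℝ ∞ f) :
    ContDiff ℝ ∞ (multiDeriv α f) :=
  multiDeriv_rel (C := fun f _ => ContDiff ℝ ∞ f) (fun j _ _ h => contDiff_partialDeriv h j) α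
    (g := f) hf

/-- Operators commuting with the partial derivatives of smooth functions commute with
`multiDeriv α`. -/
theorem multiDeriv_commute (T : (Rn d → ℝ) → Rn d → ℝ)
    (h : ∀ j f, ContDiff ℝ ∞ f → partialDeriv j (T f) = T (partialDeriv j f)) (α : Fin d →₀ ℕ)
    {f : Rn d → ℝ} (hf : ContDiff ℝ ∞ f) : multiDeriv α (T f) = T (multiDeriv α f) := by
  refine (multiDeriv_rel (C := fun f g => ContDiff ℝ ∞ f ∧ g = T f) ?_ α ⟨hf, rfl⟩).2
  rintro j f _ ⟨hf, rfl⟩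
  exact ⟨contDiff_partialDeriv hf j, h j f hf⟩

theorem partialDeriv_eventuallyEq_zero {f : Rn d → ℝ} {x : Rn d} (h : f =ᶠ[𝓝 x] 0) (j : Fin d) :
    partialDeriv j f =ᶠ[𝓝 x] 0 := by
  filter_upwards [h.eventuallyEq_nhds] with y hy
  simp [partialDeriv, hy.fderiv_eq]

theorem multiDeriv_eventuallyEq_zero {f : Rn d → ℝ} {x : Rn d} (h : f =ᶠ[𝓝 x] 0)
    (α : Fin d →₀ ℕ) : multiDeriv α f =ᶠ[𝓝 x] 0 :=
  multiDeriv_rel (C := fun f _ => f =ᶠ[𝓝 x] 0)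
    (fun j _ _ h => partialDeriv_eventuallyEq_zero h j) α (g := f) h

theorem multiDeriv_eq_zero_of_lt_norm {f : Rn d → ℝ} {R : ℝ} (h : ∀ x, R ≤ ‖x‖ → f x = 0)
    (α : Fin d →₀ ℕ) {x : Rn d} (hx : R < ‖x‖) : multiDeriv α f x = 0 := by
  refine (multiDeriv_eventuallyEq_zero ?_ α).self_of_nhds
  filter_upwards [(isOpen_lt continuous_const continuous_norm).mem_nhds hx] with y hy
  exact h y (le_of_lt hy)

theorem multiDeriv_zero (f : Rn d → ℝ) : multiDeriv 0 f = f := by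
  unfold multiDeriv
  induction List.finRange d with
  | nil => rfl
  | cons j l ih => simp

/-- The definition applies the partial derivatives in a fixed order, so the additional one arises at
the slot of `k` and is commuted outwards past the others by symmetry of second derivatives. -/
theorem multiDeriv_add_single {f : Rn d → ℝ} (hf : ContDiff ℝ ∞ f) (α : Fin d →₀ ℕ) (k : Fin d) :
    multiDeriv (α + Finsupp.single k 1) f = partialDeriv k (multiDeriv α f) := by
  have smooth_iter : ∀ (j : Fin d) (n : ℕ) (g : Rn d → ℝ), ContDiff ℝ ∞ g →
      ContDiff ℝ ∞ ((partialDeriv j)^[n] g) := by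
    intro j n g hg
    induction n with
    | zero => exact hg
    | succ n ih =>
      rw [Function.iterate_succ_apply']
      exact contDiff_partialDeriv ih j
  have comm_iter : ∀ (j : Fin d) (n : ℕ) (g : Rn d → ℝ), ContDiff ℝ ∞ g →
      (partialDeriv j)^[n] (partialDeriv k g) = partialDeriv k ((partialDeriv j)^[n] g) := by
    intro j n g hg
    induction n with
    | zero => rfl
    | succ n ih =>
      rw [Function.iterate_succ_apply', ih, partialDeriv_comm (smooth_iter j n g hg),
        Function.iterate_succ_apply']
  -- Without repetitions in the list, the additional derivative is picked up at most once.
  have key : ∀ l : List (Fin d), l.Nodup →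
      ContDiff ℝ ∞ (l.foldr (fun j g => (partialDeriv j)^[α j] g) f) ∧
      l.foldr (fun j g => (partialDeriv j)^[(α + Finsupp.single k 1 : Fin d →₀ ℕ) j] g) f =
        if k ∈ l then partialDeriv k (l.foldr (fun j g => (partialDeriv j)^[α j] g) f)
        else l.foldr (fun j g => (partialDeriv j)^[α j] g) f := by
    intro l hl
    induction l with
    | nil => exact ⟨hf, rfl⟩
    | cons j l ih =>
      obtain ⟨hj, hl⟩ := List.nodup_cons.1 hl
      obtain ⟨h1, h2⟩ := ih hl
      refine ⟨smooth_iter j _ _ h1, ?_⟩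
      simp only [List.foldr_cons]
      rw [h2]
      by_cases hjk : j = k
      · subst hjk
        simp [hj, Function.iterate_succ_apply']
      · have : (α + Finsupp.single k 1 : Fin d →₀ ℕ) j = α j := by simp [Ne.symm hjk]
        rw [this]
        by_cases hk : k ∈ l
        · simp only [hk, List.mem_cons, or_true, if_true]
          exact comm_iter j _ _ h1
        · simp [hk, Ne.symm hjk]
  have := (key _ (List.nodup_finRange d)).2
  rwa [if_pos (List.mem_finRange k)] at this

theorem multiDeriv_add (β : Fin d →₀ ℕ) :
    ∀ (α : Fin d →₀ ℕ) {f : Rn d → ℝ}, ContDiff ℝ ∞ f →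
      multiDeriv (α + β) f = multiDeriv β (multiDeriv α f) := by
  induction β using Finsupp.induction_linear with
  | zero => intro α f _; rw [add_zero, multiDeriv_zero]
  | add β γ hβ hγ =>
    intro α f hf
    rw [← add_assoc, hγ _ hf, hβ _ hf, ← hγ _ (contDiff_multiDeriv α hf)]
  | single k n =>
    induction n with
    | zero => intro α f _; simp [multiDeriv_zero]
    | succ n ih =>
      intro α f hf
      rw [Finsupp.single_add, ← add_assoc, multiDeriv_add_single hf, ih _ hf,
        multiDeriv_add_single (contDiff_multiDeriv α hf)]

theorem multiDeriv_comp_add_left (α : Fin d →₀ ℕ) (z : Rn d) {f : Rn d → ℝ}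
    (hf : ContDiff ℝ ∞ f) :
    multiDeriv α (fun y => f (z + y)) = fun y => multiDeriv α f (z + y) := by
  refine multiDeriv_commute (fun f y => f (z + y)) (fun j f _ => ?_) α hf
  funext y
  simp only [partialDeriv, fderiv_comp_add_left]

theorem multiDeriv_const_mul (α : Fin d →₀ ℕ) (c : ℝ) {f : Rn d → ℝ} (hf : ContDiff ℝ ∞ f) :
    multiDeriv α (fun y => c * f y) = fun y => c * multiDeriv α f y := by
  refine multiDeriv_commute (fun f y => c * f y) (fun j f hf => ?_) α hf
  funext y
  simp [partialDeriv, fderiv_const_mul (differentiable_of_smooth hf y)]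

/-- A function whose second partial derivatives are bounded by `C` is Lipschitz-differentiable. -/
theorem abs_sub_taylor_le {f : Rn d → ℝ} (hf : ContDiff ℝ ∞ f) {C : Fin d → Fin d → ℝ}
    (hC : ∀ j k x, |partialDeriv j (partialDeriv k f) x| ≤ C j k) (a y : Rn d) :
    |f y - f a - coordForm (fun j => partialDeriv j f a) (y - a)| ≤
      (∑ k, ∑ j, C j k) * ‖y - a‖ * ‖y - a‖ := by
  have lip : ∀ k x, |partialDeriv k f x - partialDeriv k f a| ≤ (∑ j, C j k) * ‖x - a‖ := by
    intro k x
    refine (convex_univ (𝕜 := ℝ) (E := Rn d)).norm_image_sub_le_of_norm_fderiv_le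
      (fun z _ => differentiable_of_smooth (contDiff_partialDeriv hf k) z) (fun z _ => ?_)
      (Set.mem_univ a) (Set.mem_univ x)
    rw [fderiv_eq_coordForm]
    exact (norm_coordForm_le _).trans (Finset.sum_le_sum fun j _ => hC j k z)
  -- Mean value inequality for f minus its linear part, on a ball where the gradient varies by at
  -- most a multiple of ‖y - a‖.
  refine (convex_closedBall a ‖y - a‖).norm_image_sub_le_of_norm_hasFDerivWithin_le'
    (f' := fun x => fderiv ℝ f x)
    (fun x _ => (differentiable_of_smooth hf x).hasFDerivAt.hasFDerivWithinAt) (fun x hx => ?_)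
    (Metric.mem_closedBall_self (norm_nonneg _)) (by simp [dist_eq_norm])
  rw [fderiv_eq_coordForm, coordForm_sub]
  refine (norm_coordForm_le _).trans ?_
  rw [Finset.sum_mul]
  refine Finset.sum_le_sum fun k _ => (lip k x).trans ?_
  have h0 : 0 ≤ ∑ j, C j k := Finset.sum_nonneg fun j _ => (abs_nonneg _).trans (hC j k a)
  rw [Metric.mem_closedBall, dist_eq_norm] at hx
  gcongr

theorem abs_sub_le_of_partialDeriv_le {f : Rn d → ℝ} (hf : ContDiff ℝ ∞ f) {C : Fin d → ℝ}
    (hC : ∀ j x, |partialDeriv j f x| ≤ C j) (a y : Rn d) :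
    |f y - f a| ≤ (∑ j, C j) * ‖y - a‖ := by
  refine (convex_univ (𝕜 := ℝ) (E := Rn d)).norm_image_sub_le_of_norm_fderiv_le
    (fun z _ => differentiable_of_smooth hf z) (fun z _ => ?_) (Set.mem_univ a) (Set.mem_univ y)
  rw [fderiv_eq_coordForm]
  exact (norm_coordForm_le _).trans (Finset.sum_le_sum fun j _ => hC j z)

theorem hasCompactSupport_of_norm {f : Rn d → ℝ} {R : ℝ} (h : ∀ x, R ≤ ‖x‖ → f x = 0) :
    HasCompactSupport f := by
  refine HasCompactSupport.intro (isCompact_closedBall (0 : Rn d) R) fun x hx => h x ?_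
  simpa using (not_le.1 (by simpa using hx) : R < ‖x‖).le

theorem exists_norm_of_hasCompactSupport {f : Rn d → ℝ} (h : HasCompactSupport f) :
    ∃ R : ℝ, ∀ x, R ≤ ‖x‖ → f x = 0 := by
  obtain ⟨R, hR⟩ := (Metric.isBounded_iff_subset_closedBall 0).1 h.isCompact.isBounded
  refine ⟨R + 1, fun x hx => image_eq_zero_of_notMem_tsupport fun hxs => ?_⟩
  have := hR hxs
  simp at this
  linarith

end Calculus

/-! ### Convolution with a compactly supported factor. -/

section Convolution

variable {d : ℕ}

theorem continuous_conv_integrand {E f : Rn d → ℝ} (hE : Continuous E) (hf : Continuous f)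
    (x : Rn d) : Continuous fun y => E (x - y) * f y := by fun_prop

/-- Differentiation under the integral. For x in the unit ball about x₀ and y in the support of f, x
- y stays in a compact set, where the gradient of E is bounded; this gives the dominating function.
-/
theorem hasFDerivAt_conv {E f : Rn d → ℝ} (hE : ContDiff ℝ ∞ E) (hf : Continuous f)
    (hc : HasCompactSupport f) (x₀ : Rn d) :
    HasFDerivAt (conv E f) (coordForm fun j => conv (partialDeriv j E) f x₀) x₀ := by
  have hE' : Continuous (fderiv ℝ E) := hE.continuous_fderiv (by simp)
  have hK : IsCompact ((fun p : Rn d × Rn d => p.1 - p.2) ''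
      (Metric.closedBall x₀ 1 ×ˢ tsupport f)) :=
    ((isCompact_closedBall x₀ 1).prod hc.isCompact).image (by fun_prop)
  obtain ⟨C, hC⟩ := hK.exists_bound_of_continuousOn hE'.continuousOn
  have hF : coordForm (fun j => conv (partialDeriv j E) f x₀) =
      ∫ y, f y • fderiv ℝ E (x₀ - y) := by
    have hint : Integrable (fun y => f y • fderiv ℝ E (x₀ - y)) :=
      Continuous.integrable_of_hasCompactSupport (by fun_prop) hc.smul_right
    rw [eq_coordForm (∫ y, f y • fderiv ℝ E (x₀ - y))]
    congr 1
    funext j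
    rw [ContinuousLinearMap.integral_apply hint]
    simp [conv, partialDeriv, mul_comm]
  rw [hF]
  refine hasFDerivAt_integral_of_dominated_of_fderiv_le (μ := (volume : Measure (Rn d)))
    (𝕜 := ℝ) (F := fun x y => E (x - y) * f y) (F' := fun x y => f y • fderiv ℝ E (x - y))
    (x₀ := x₀) (bound := fun y => C * ‖f y‖) (Metric.closedBall_mem_nhds x₀ one_pos)
    (Eventually.of_forall fun x =>
      (continuous_conv_integrand hE.continuous hf x).aestronglyMeasurable)
    ((continuous_conv_integrand hE.continuous hf x₀).integrable_of_hasCompactSupport hc.mul_left)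
    (Continuous.aestronglyMeasurable (by fun_prop))
    (Eventually.of_forall fun y x hx => ?_)
    ((hf.integrable_of_hasCompactSupport hc).norm.const_mul C)
    (Eventually.of_forall fun y x _ => ?_)
  · rw [norm_smul, mul_comm]
    by_cases hy : y ∈ tsupport f
    · gcongr
      exact hC _ ⟨(x, y), ⟨hx, hy⟩, rfl⟩
    · simp [image_eq_zero_of_notMem_tsupport hy]
  · have h1 : HasFDerivAt (fun x => E (x - y)) (fderiv ℝ E (x - y)) x := by
      have := (differentiable_of_smooth hE (x - y)).hasFDerivAt.comp x
        ((hasFDerivAt_id x).sub_const y)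
      simpa [Function.comp_def] using this
    exact h1.mul_const (f y)

theorem partialDeriv_conv {E f : Rn d → ℝ} (hE : ContDiff ℝ ∞ E) (hf : Continuous f)
    (hc : HasCompactSupport f) (j : Fin d) :
    partialDeriv j (conv E f) = conv (partialDeriv j E) f :=
  partialDeriv_eq_of_hasFDerivAt (fun x => hasFDerivAt_conv hE hf hc x) j

/-- Convolutions of f with all smooth kernels form a family closed under partial derivatives. -/
theorem contDiff_conv {E f : Rn d → ℝ} (hE : ContDiff ℝ ∞ E) (hf : Continuous f)
    (hc : HasCompactSupport f) : ContDiff ℝ ∞ (conv E f) :=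
  contDiff_of_closed_family (A := {E : Rn d → ℝ // ContDiff ℝ ∞ E}) (fun E => conv E.1 f)
    (fun j E => ⟨partialDeriv j E.1, contDiff_partialDeriv E.2 j⟩)
    (fun E x => hasFDerivAt_conv E.2 hf hc x) ⟨E, hE⟩

theorem multiDeriv_conv {E f : Rn d → ℝ} (hE : ContDiff ℝ ∞ E) (hf : Continuous f)
    (hc : HasCompactSupport f) (α : Fin d →₀ ℕ) :
    multiDeriv α (conv E f) = conv (multiDeriv α E) f :=
  multiDeriv_commute (fun E => conv E f) (fun j _ hE => partialDeriv_conv hE hf hc j) α hE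

theorem contDiff_polyDiff (P : MvPolynomial (Fin d) ℝ) {E : Rn d → ℝ} (hE : ContDiff ℝ ∞ E) :
    ContDiff ℝ ∞ (polyDiff P E) :=
  ContDiff.sum fun α _ => contDiff_const.mul (contDiff_multiDeriv α hE)

theorem polyDiff_conv (P : MvPolynomial (Fin d) ℝ) {E f : Rn d → ℝ} (hE : ContDiff ℝ ∞ E)
    (hf : Continuous f) (hc : HasCompactSupport f) :
    polyDiff P (conv E f) = conv (polyDiff P E) f := by
  funext x
  simp only [polyDiff, conv, Finset.sum_mul]
  rw [integral_finsetSum]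
  · refine Finset.sum_congr rfl fun α _ => ?_
    rw [multiDeriv_conv hE hf hc, conv, ← integral_const_mul]
    simp only [mul_assoc]
  · intro α _
    have := (contDiff_multiDeriv α hE).continuous
    exact Continuous.integrable_of_hasCompactSupport (by fun_prop) hc.mul_left

/-- Transposing a convolution operator reflects its kernel. -/
theorem integral_conv_mul {D f φ : Rn d → ℝ} (hD : Continuous D) (hf : Continuous f)
    (hφ : Continuous φ) (hfc : HasCompactSupport f) (hφc : HasCompactSupport φ) :
    ∫ x, conv D f x * φ x = ∫ z, conv φ (fun y => f (-y)) z * D z := by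
  have h1 : ∀ x, conv D f x * φ x = ∫ z, D z * f (x - z) * φ x := by
    intro x
    rw [conv, ← integral_sub_left_eq_self (fun y => D (x - y) * f y) volume x,
      ← integral_mul_const]
    simp
  have h2 : ∀ z, conv φ (fun y => f (-y)) z * D z = ∫ x, D z * f (x - z) * φ x := by
    intro z
    rw [conv, ← integral_sub_left_eq_self (fun y => φ (z - y) * f (-y)) volume z,
      ← integral_mul_const]
    refine integral_congr_ae (Eventually.of_forall fun x => ?_)
    simp
    ring
  simp only [h1, h2]
  refine integral_integral_swap_of_hasCompactSupport
    (f := fun x z => D z * f (x - z) * φ x) ?_ ?_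
  · unfold Function.uncurry
    fun_prop
  -- The supports of φ and f confine x and x - z, hence z as well; D needs no compact support.
  · refine HasCompactSupport.intro (K := (fun p : Rn d × Rn d => (p.1, p.1 - p.2)) ''
      (tsupport φ ×ˢ tsupport f)) ((hφc.isCompact.prod hfc.isCompact).image (by fun_prop)) ?_
    rintro ⟨x, z⟩ hxz
    by_contra hne
    refine hxz ⟨(x, x - z), ⟨?_, ?_⟩, by simp⟩
    · exact subset_tsupport _ fun h => hne (by simp [Function.uncurry, h])
    · exact subset_tsupport _ fun h => hne (by simp [Function.uncurry, h])

end Convolution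

/-! ### Translation to representatives, saturation, and bounds on test functions. -/

section Representatives

variable {ι : Type*} {U : Ultrafilter ι} {d : ℕ}

/-- The saturation property of countably incomplete ultrafilters: countably many conditions, each
of which holds almost everywhere, hold up to an infinite index. -/
theorem exists_infinite_index (hU : ¬ CountableInterFilter (U : Filter ι)) {P : ℕ → ι → Prop}
    (hP : ∀ n, ∀ᶠ i in (U : Filter ι), P n i) :
    ∃ N : ι → ℕ, Tendsto N U atTop ∧ ∀ᶠ i in (U : Filter ι), P (N i) i := by
  obtain ⟨A, hA, hAU⟩ : ∃ A : ℕ → Set ι, (∀ n, A n ∈ U) ∧ ⋂ n, A n ∉ U := by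
    by_contra! h
    refine hU ⟨fun S hS hSU => ?_⟩
    rcases S.eq_empty_or_nonempty with rfl | hne
    · simp
    · obtain ⟨A, rfl⟩ := hS.exists_eq_range hne
      rw [Set.sInter_range]
      exact h A fun n => hSU _ ⟨n, rfl⟩
  set B : ℕ → Set ι := fun n => {i | ∀ k ≤ n, i ∈ A k ∧ P k i} with hB
  have hBU : ∀ n, B n ∈ (U : Filter ι) := by
    intro n
    have : ∀ᶠ i in (U : Filter ι), ∀ k ∈ Set.Iic n, i ∈ A k ∧ P k i :=
      (eventually_all_finite (Set.finite_Iic n)).2 fun k _ =>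
        (show ∀ᶠ i in (U : Filter ι), i ∈ A k from hA k).and (hP k)
    exact this
  have hbdd : ∀ i ∉ ⋂ n, A n, BddAbove {n | i ∈ B n} := by
    intro i hi
    obtain ⟨m, hm⟩ : ∃ m, i ∉ A m := by simpa using hi
    exact ⟨m, fun n hn => not_lt.1 fun hmn => hm (hn m hmn.le).1⟩
  have hc : ∀ᶠ i in (U : Filter ι), i ∉ ⋂ n, A n := Ultrafilter.compl_mem_iff_notMem.2 hAU
  refine ⟨fun i => sSup {n | i ∈ B n}, tendsto_atTop.2 fun n => ?_, ?_⟩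
  · filter_upwards [hc, hBU n] with i hi hn using le_csSup (hbdd i hi) hn
  · filter_upwards [hc, hBU 0] with i hi h0
    have : sSup {n | i ∈ B n} ∈ {n | i ∈ B n} := Nat.sSup_mem ⟨0, h0⟩ (hbdd i hi)
    exact (this _ le_rfl).2

theorem near_coe_iff {V : Type*} [NormedAddCommGroup V] {x y : ι → V} :
    Near ((x : Germ (U : Filter ι) V) : Star U V) (y : Germ (U : Filter ι) V) ↔
      Tendsto (fun i => x i - y i) U (𝓝 0) := by
  rw [Metric.tendsto_nhds]
  simp only [dist_zero_right]
  refine forall₂_congr fun ε _ => ?_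
  exact Germ.coe_lt

theorem nearstandard_coe_iff {V : Type*} [NormedAddCommGroup V] {x : ι → V} :
    Nearstandard ((x : Germ (U : Filter ι) V) : Star U V) ↔ ∃ a, Tendsto x U (𝓝 a) := by
  refine exists_congr fun a => ?_
  rw [← tendsto_sub_nhds_zero_iff]
  exact near_coe_iff (y := fun _ => a)

theorem isInfinite_coe_iff {V : Type*} [NormedAddCommGroup V] {x : ι → V} :
    IsInfinite ((x : Germ (U : Filter ι) V) : Star U V) ↔
      ∀ R : ℝ, ∀ᶠ i in (U : Filter ι), R < ‖x i‖ := by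
  rw [IsInfinite, not_exists]
  refine forall_congr' fun R => ?_
  have : (starNorm ((x : Germ (U : Filter ι) V) : Star U V) ≤ std U R) ↔
      ∀ᶠ i in (U : Filter ι), ‖x i‖ ≤ R := Germ.coe_le
  rw [this, ← Ultrafilter.eventually_not]
  simp only [not_le]

theorem exists_tendsto_of_norm_le {V : Type*} [NormedAddCommGroup V] [ProperSpace V] {x : ι → V}
    {R : ℝ} (h : ∀ᶠ i in (U : Filter ι), ‖x i‖ ≤ R) : ∃ a, Tendsto x U (𝓝 a) := by
  have h' : (U.map x : Filter V) ≤ 𝓟 (Metric.closedBall 0 R) := by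
    refine le_principal_iff.2 (h.mono fun i hi => ?_)
    simpa using hi
  obtain ⟨a, -, ha⟩ := (isCompact_closedBall (0 : V) R).ultrafilter_le_nhds _ h'
  exact ⟨a, ha⟩

theorem isStarSmooth_coe_iff {f : ι → Rn d → ℝ} :
    IsStarSmooth ((f : Germ (U : Filter ι) (Rn d → ℝ)) : StarFun U d) ↔
      ∀ᶠ i in (U : Filter ι), ContDiff ℝ ∞ (f i) := Iff.rfl

theorem forall_star_iff {X : Type*} {p : Star U X → Prop} :
    (∀ x, p x) ↔ ∀ x : ι → X, p ((x : Germ (U : Filter ι) X) : Star U X) :=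
  ⟨fun h x => h x, fun h x => Quotient.inductionOn' x h⟩

/-- Otherwise, counterexamples chosen index by index form an internal point violating the
hypothesis. -/
theorem SCompactlySupported.exists_norm {f : ι → Rn d → ℝ}
    (h : SCompactlySupported ((f : Germ (U : Filter ι) (Rn d → ℝ)) : StarFun U d)) :
    ∃ R : ℝ, ∀ᶠ i in (U : Filter ι), ∀ x, R ≤ ‖x‖ → f i x = 0 := by
  obtain ⟨R, hR⟩ := h
  refine ⟨R, ?_⟩
  by_contra! hne
  obtain ⟨x, hx⟩ := hne.choice
  have h1 := hR ((x : Germ (U : Filter ι) (Rn d)) : Star U (Rn d))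
    (Germ.coe_le.2 (hx.mono fun i hi => hi.1))
  have h2 : ∀ᶠ i in (U : Filter ι), f i (x i) = 0 := Germ.coe_eq.1 h1
  obtain ⟨i, hi, hi'⟩ := (hx.and h2).exists
  exact hi.2 hi'

/-- A family whose derivatives are bounded, uniformly along the ultrafilter, converges with all
its derivatives to a smooth function. -/
theorem exists_smooth_ultralimit {u : ι → Rn d → ℝ}
    (hu : ∀ᶠ i in (U : Filter ι), ContDiff ℝ ∞ (u i))
    (hb : ∀ α : Fin d →₀ ℕ, ∃ C : ℝ, ∀ᶠ i in (U : Filter ι), ∀ x, |multiDeriv α (u i) x| ≤ C) :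
    ∃ g : Rn d → ℝ, ContDiff ℝ ∞ g ∧ ∀ (α : Fin d →₀ ℕ) (a : Rn d) (x : ι → Rn d),
      Tendsto x U (𝓝 a) →
        Tendsto (fun i => multiDeriv α (u i) (x i)) U (𝓝 (multiDeriv α g a)) := by
  choose C hC using hb
  have hlim : ∀ (α : Fin d →₀ ℕ) (a : Rn d),
      ∃ l, Tendsto (fun i => multiDeriv α (u i) a) U (𝓝 l) := fun α a =>
    exists_tendsto_of_norm_le (R := C α) ((hC α).mono fun i hi => hi a)
  choose G hG using hlim
  let s : Fin d → (Fin d →₀ ℕ) → Fin d →₀ ℕ := fun j α => α + Finsupp.single j 1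
  have hderiv : ∀ α a, HasFDerivAt (G α) (coordForm fun j => G (s j α) a) a := by
    intro α a
    set K : ℝ := ∑ k, ∑ j, C (s j (s k α)) with hK
    -- The Taylor estimate has a constant independent of i, so it survives the pointwise ultralimit
    -- and makes the limits differentiable.
    have hbound : ∀ y, |G α y - G α a - coordForm (fun j => G (s j α) a) (y - a)| ≤
        K * ‖y - a‖ * ‖y - a‖ := by
      intro y
      have ht : Tendsto (fun i => |multiDeriv α (u i) y - multiDeriv α (u i) a -
          coordForm (fun j => multiDeriv (s j α) (u i) a) (y - a)|) U
          (𝓝 |G α y - G α a - coordForm (fun j => G (s j α) a) (y - a)|) := by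
        simp only [coordForm_apply]
        exact (((hG α y).sub (hG α a)).sub
          (tendsto_finsetSum _ fun j _ => (hG (s j α) a).mul_const _)).abs
      refine le_of_tendsto ht ?_
      have hall : ∀ᶠ i in (U : Filter ι), ∀ j k, ∀ x,
          |multiDeriv (s j (s k α)) (u i) x| ≤ C (s j (s k α)) :=
        eventually_all.2 fun j => eventually_all.2 fun k => hC _
      filter_upwards [hu, hall] with i hi hCi
      have := abs_sub_taylor_le (contDiff_multiDeriv α hi)
        (C := fun j k => C (s j (s k α))) (fun j k x => by
          rw [← multiDeriv_add_single hi, ← multiDeriv_add_single hi]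
          exact hCi j k x) a y
      simpa only [← multiDeriv_add_single hi] using this
    rw [hasFDerivAt_iff_isLittleO]
    have h1 : (fun y => G α y - G α a - coordForm (fun j => G (s j α) a) (y - a)) =O[𝓝 a]
        fun y => ‖y - a‖ * ‖y - a‖ :=
      Asymptotics.IsBigO.of_bound K (Eventually.of_forall fun y => by
        rw [Real.norm_eq_abs, norm_mul, norm_norm, ← mul_assoc]
        exact hbound y)
    refine h1.trans_isLittleO ?_
    have h2 : (fun y : Rn d => ‖y - a‖) =o[𝓝 a] fun _ => (1 : ℝ) := by
      rw [Asymptotics.isLittleO_one_iff]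
      have : Continuous fun y : Rn d => ‖y - a‖ := by fun_prop
      simpa using this.tendsto a
    have h3 := h2.mul_isBigO (Asymptotics.isBigO_refl (fun y : Rn d => ‖y - a‖) (𝓝 a))
    simp only [one_mul] at h3
    exact h3.trans_isBigO (Asymptotics.isBigO_refl _ _).norm_left
  have hsmooth : ∀ α, ContDiff ℝ ∞ (G α) := contDiff_of_closed_family G s hderiv
  have hpartial : ∀ α j, partialDeriv j (G α) = G (s j α) := fun α j =>
    partialDeriv_eq_of_hasFDerivAt (hderiv α) j
  have hmulti : ∀ β α : Fin d →₀ ℕ, multiDeriv β (G α) = G (α + β) := by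
    intro β
    induction β using Finsupp.induction_linear with
    | zero => intro α; rw [multiDeriv_zero, add_zero]
    | add β γ hβ hγ => intro α; rw [multiDeriv_add γ β (hsmooth α), hβ, hγ, add_assoc]
    | single k n =>
      induction n with
      | zero => intro α; simp [multiDeriv_zero]
      | succ n ih =>
        intro α
        rw [Finsupp.single_add, multiDeriv_add_single (hsmooth α), ih, hpartial, ← add_assoc]
  refine ⟨G 0, hsmooth 0, fun α a x hx => ?_⟩
  rw [hmulti, zero_add]
  have hall : ∀ᶠ i in (U : Filter ι), ∀ j, ∀ x, |multiDeriv (s j α) (u i) x| ≤ C (s j α) :=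
    eventually_all.2 fun j => hC _
  -- A uniform Lipschitz bound allows the moving point to be replaced by its limit.
  have hz : Tendsto (fun i => multiDeriv α (u i) (x i) - multiDeriv α (u i) a) U (𝓝 0) := by
    refine squeeze_zero_norm' (a := fun i => (∑ j, C (s j α)) * ‖x i - a‖) ?_ ?_
    · filter_upwards [hu, hall] with i hi hCi
      exact abs_sub_le_of_partialDeriv_le (contDiff_multiDeriv α hi) (fun j x => by
        rw [← multiDeriv_add_single hi]
        exact hCi j x) a (x i)
    · have := (tendsto_sub_nhds_zero_iff.2 hx).norm.const_mul (∑ j, C (s j α))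
      simpa using this
  simpa using hz.add (hG α a)

/-- The standard witness is the ultralimit of the representatives, which inherits the radius R. -/
theorem nearTestFunction_coe {φ : ι → Rn d → ℝ}
    (hφ : ∀ᶠ i in (U : Filter ι), ContDiff ℝ ∞ (φ i)) {R : ℝ}
    (hR : ∀ᶠ i in (U : Filter ι), ∀ x, R ≤ ‖x‖ → φ i x = 0)
    (hb : ∀ α : Fin d →₀ ℕ, ∃ C : ℝ, ∀ᶠ i in (U : Filter ι), ∀ x, |multiDeriv α (φ i) x| ≤ C) :
    NearTestFunction ((φ : Germ (U : Filter ι) (Rn d → ℝ)) : StarFun U d) := by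
  obtain ⟨g, hg, hlim⟩ := exists_smooth_ultralimit hφ hb
  have hgR : ∀ x, R ≤ ‖x‖ → g x = 0 := by
    intro x hx
    have h1 := hlim 0 x _ tendsto_const_nhds
    simp only [multiDeriv_zero] at h1
    exact tendsto_nhds_unique_of_eventuallyEq h1 tendsto_const_nhds
      (hR.mono fun i hi => hi x hx)
  refine ⟨g, hg, hasCompactSupport_of_norm hgR,
    ⟨hφ, Eventually.of_forall fun _ => hg, fun α => ?_⟩, ?_⟩
  · refine forall_star_iff.2 fun x hx => ?_
    obtain ⟨a, ha⟩ := nearstandard_coe_iff.1 hx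
    refine near_coe_iff.2 ?_
    have h2 := ((contDiff_multiDeriv α hg).continuous.tendsto a).comp ha
    simpa using (hlim α a x ha).sub h2
  · refine forall_star_iff.2 fun x hx => Germ.coe_eq.2 ?_
    filter_upwards [hR, isInfinite_coe_iff.1 hx R] with i hi hxi
    exact (hi _ hxi.le).trans (hgR _ hxi.le).symm

/-- Without a common radius, saturation yields an infinite point where φ ≠ 0, although φ agrees
there with the compactly supported g. Any point with a too large derivative lies in the support
ball, so it is nearstandard, and the derivative is infinitely close to a bounded one. -/
theorem NearTestFunction.exists_bounds (hU : ¬ CountableInterFilter (U : Filter ι))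
    {φ : ι → Rn d → ℝ}
    (h : NearTestFunction ((φ : Germ (U : Filter ι) (Rn d → ℝ)) : StarFun U d)) :
    (∀ᶠ i in (U : Filter ι), ContDiff ℝ ∞ (φ i)) ∧
    (∃ R : ℝ, ∀ᶠ i in (U : Filter ι), ∀ x, R ≤ ‖x‖ → φ i x = 0) ∧
    ∀ α : Fin d →₀ ℕ, ∃ C : ℝ, ∀ᶠ i in (U : Filter ι), ∀ x, |multiDeriv α (φ i) x| ≤ C := by
  obtain ⟨g, hg, hgc, ⟨hφ, -, hnear⟩, hinf⟩ := h
  have hsupp : ∃ R : ℝ, ∀ᶠ i in (U : Filter ι), ∀ x, R ≤ ‖x‖ → φ i x = 0 := by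
    by_contra! hne
    obtain ⟨N, hN, hx⟩ := exists_infinite_index hU fun n : ℕ => hne n
    obtain ⟨x, hx⟩ := hx.choice
    have hxN : ∀ R : ℝ, ∀ᶠ i in (U : Filter ι), R < ‖x i‖ := by
      intro R
      filter_upwards [hx, (tendsto_natCast_atTop_atTop.comp hN).eventually_gt_atTop R]
        with i hi hRi using lt_of_lt_of_le hRi hi.1
    have h2 : ∀ᶠ i in (U : Filter ι), φ i (x i) = g (x i) :=
      Germ.coe_eq.1 (hinf _ (isInfinite_coe_iff.2 hxN))
    obtain ⟨R, hR⟩ := exists_norm_of_hasCompactSupport hgc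
    obtain ⟨i, ⟨hi, hi'⟩, hRi⟩ := ((hx.and h2).and (hxN R)).exists
    exact hi.2 (hi'.trans (hR _ hRi.le))
  refine ⟨hφ, hsupp, fun α => ?_⟩
  obtain ⟨R, hR⟩ := hsupp
  obtain ⟨S, hS⟩ := exists_norm_of_hasCompactSupport hgc
  have hac : HasCompactSupport (multiDeriv α g) :=
    hasCompactSupport_of_norm (R := S + 1) fun x hx =>
      multiDeriv_eq_zero_of_lt_norm hS α (by linarith)
  obtain ⟨C, hC⟩ := hac.exists_bound_of_continuous (contDiff_multiDeriv α hg).continuous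
  -- The extra 1 absorbs the infinitesimal difference from the derivative of g.
  refine ⟨C + 1, ?_⟩
  by_contra! hne
  obtain ⟨x, hx⟩ := hne.choice
  have hxR : ∀ᶠ i in (U : Filter ι), ‖x i‖ ≤ R := by
    filter_upwards [hx, hR] with i hi hRi
    by_contra! hlt
    rw [multiDeriv_eq_zero_of_lt_norm hRi α hlt, abs_zero] at hi
    linarith [(norm_nonneg _).trans (hC 0)]
  have h1 := near_coe_iff.1 (hnear α _ (nearstandard_coe_iff.2 (exists_tendsto_of_norm_le hxR)))
  have h2 : ∀ᶠ i in (U : Filter ι), ‖multiDeriv α (φ i) (x i) - multiDeriv α g (x i)‖ < 1 := by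
    have := h1.norm.eventually_lt_const (u := 1) (by simp)
    exact this
  obtain ⟨i, hi, hi'⟩ := (hx.and h2).exists
  have h3 := hC (x i)
  rw [Real.norm_eq_abs] at h3 hi'
  have := abs_sub_abs_le_abs_sub (multiDeriv α (φ i) (x i)) (multiDeriv α g (x i))
  linarith

/-- The continuity estimate for elements of `D'`. -/
theorem MemD'.exists_bound (hU : ¬ CountableInterFilter (U : Filter ι)) {f : ι → Rn d → ℝ}
    (h : MemD' ((f : Germ (U : Filter ι) (Rn d → ℝ)) : StarFun U d)) (R : ℝ) :
    ∃ n : ℕ, ∀ᶠ i in (U : Filter ι), ∀ (η : Rn d → ℝ) (M : ℝ), ContDiff ℝ ∞ η →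
      (∀ x, R ≤ ‖x‖ → η x = 0) →
      (∀ α : Fin d →₀ ℕ, (∀ j, α j ≤ n) → ∀ x, |multiDeriv α η x| ≤ M) →
      |∫ x, f i x * η x| ≤ ((n : ℝ) + 1) ^ 2 * M := by
  -- One parameter n governs both the order and the constant, so a single diagonal choice N(i)
  -- defeats all standard values at once.
  by_contra! hne
  have h1 : ∀ n : ℕ, ∀ᶠ i in (U : Filter ι), ∃ η : Rn d → ℝ, ContDiff ℝ ∞ η ∧
      (∀ x, R ≤ ‖x‖ → η x = 0) ∧
      (∀ α : Fin d →₀ ℕ, (∀ j, α j ≤ n) → ∀ x, |multiDeriv α η x| ≤ ((n : ℝ) + 1)⁻¹) ∧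
      ∫ x, f i x * η x = n + 1 := by
    intro n
    filter_upwards [hne n] with i hi
    obtain ⟨η, M, hη, hηR, hηM, hM⟩ := hi
    have hM0 : 0 ≤ M := (abs_nonneg _).trans (hηM 0 (by simp) 0)
    set J := ∫ x, f i x * η x with hJ
    have hn : (0 : ℝ) < n + 1 := by positivity
    have hJ0 : 0 < |J| := lt_of_le_of_lt (by positivity) hM
    -- Rescaling makes the pairing n + 1; since |J| > (n + 1)² M, the derivatives drop to at most
    -- 1/(n + 1). Below, only the bound 1 is used.
    refine ⟨fun x => (n + 1) / J * η x, contDiff_const.mul hη, fun x hx => by simp [hηR x hx],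
      fun α hα x => ?_, ?_⟩
    · rw [multiDeriv_const_mul α _ hη, abs_mul, abs_div, abs_of_pos hn, div_mul_eq_mul_div,
        div_le_iff₀ hJ0, inv_mul_eq_div, le_div_iff₀ hn]
      have := mul_le_mul_of_nonneg_left (hηM α hα x) (sq_nonneg ((n : ℝ) + 1))
      nlinarith
    · simp only [mul_left_comm (f i _)]
      rw [integral_const_mul, ← hJ, div_mul_cancel₀ _ (abs_pos.1 hJ0)]
  obtain ⟨N, hN, hη⟩ := exists_infinite_index hU h1
  obtain ⟨η, hη⟩ := hη.choice
  have hNR : Tendsto (fun i => (N i : ℝ) + 1) U atTop :=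
    tendsto_atTop_add_const_right _ _ (tendsto_natCast_atTop_atTop.comp hN)
  have hT : NearTestFunction ((η : Germ (U : Filter ι) (Rn d → ℝ)) : StarFun U d) := by
    refine nearTestFunction_coe (hη.mono fun i hi => hi.1) (hη.mono fun i hi => hi.2.1)
      fun α => ⟨1, ?_⟩
    have hα : ∀ᶠ i in (U : Filter ι), ∀ j, α j ≤ N i :=
      eventually_all.2 fun j => hN.eventually_ge_atTop (α j)
    filter_upwards [hη, hα] with i hi hαi x
    refine (hi.2.2.1 α hαi x).trans (inv_le_one_of_one_le₀ ?_)
    simp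
  -- The diagonal function is a test function, yet its pairing with f is the infinite number N + 1.
  obtain ⟨a, ha⟩ := nearstandard_coe_iff.1 (h.2 _ hT)
  refine not_tendsto_nhds_of_tendsto_atTop hNR a (ha.congr' ?_)
  filter_upwards [hη] with i hi using hi.2.2.2

end Representatives

/-! ### Correlation of f with a test function. -/

section WeakSolution

variable {ι : Type*} {U : Ultrafilter ι} {d : ℕ}

/-- Displays the correlation as f paired with a translate of φ; at z = 0 it is ∫ f φ. -/
theorem conv_neg_eq_integral (φ f : Rn d → ℝ) (z : Rn d) :
    conv φ (fun y => f (-y)) z = ∫ y, f y * φ (z + y) := by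
  rw [conv, ← integral_neg_eq_self]
  simp [mul_comm]

/-- The correlation of a test function with an S-compactly supported element of `D'` is a test
function. -/
theorem nearTestFunction_conv_neg (hU : ¬ CountableInterFilter (U : Filter ι))
    {f φ : ι → Rn d → ℝ}
    (hf : MemD' ((f : Germ (U : Filter ι) (Rn d → ℝ)) : StarFun U d))
    (hfc : SCompactlySupported ((f : Germ (U : Filter ι) (Rn d → ℝ)) : StarFun U d))
    (hφ : NearTestFunction ((φ : Germ (U : Filter ι) (Rn d → ℝ)) : StarFun U d)) :
    NearTestFunction (((fun i => conv (φ i) fun y => f i (-y)) :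
      Germ (U : Filter ι) (Rn d → ℝ)) : StarFun U d) := by
  obtain ⟨hφs, ⟨R, hR⟩, hb⟩ := hφ.exists_bounds hU
  obtain ⟨S, hS⟩ := hfc.exists_norm
  have hfs : ∀ᶠ i in (U : Filter ι), ContDiff ℝ ∞ (f i) := hf.1
  have hvanish : ∀ᶠ i in (U : Filter ι), ∀ x, R + S ≤ ‖x‖ →
      conv (φ i) (fun y => f i (-y)) x = 0 := by
    filter_upwards [hR, hS] with i hRi hSi x hx
    rw [conv_neg_eq_integral]
    refine integral_eq_zero_of_ae (Eventually.of_forall fun y => ?_)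
    by_cases hy : S ≤ ‖y‖
    · simp [hSi y hy]
    · have h1 : ‖x‖ ≤ ‖x + y‖ + ‖y‖ := by simpa using norm_sub_le (x + y) y
      simp [hRi (x + y) (by linarith)]
  refine nearTestFunction_coe ?_ hvanish fun α => ?_
  · filter_upwards [hφs, hfs, hS] with i hφi hfi hSi
    exact contDiff_conv hφi (hfi.continuous.comp continuous_neg)
      (hasCompactSupport_of_norm (R := S) fun x hx => hSi _ (by simpa using hx))
  · choose C hC using hb
    -- For ‖z‖ ≤ R + S, every y ↦ φ(z + y) is supported in this ball; the 1 gives the strict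
    -- inequality needed for its derivatives to vanish. For larger z the correlation vanishes.
    obtain ⟨n, hn⟩ := hf.exists_bound hU (|R + S| + |R| + 1)
    let s : Finset (Fin d →₀ ℕ) := Finset.Iic (Finsupp.equivFunOnFinite.symm fun _ => n)
    refine ⟨((n : ℝ) + 1) ^ 2 * ∑ β ∈ s, |C (α + β)|, ?_⟩
    have hall : ∀ᶠ i in (U : Filter ι), ∀ β ∈ s, ∀ x,
        |multiDeriv (α + β) (φ i) x| ≤ C (α + β) :=
      (eventually_all_finset s).2 fun β _ => hC _
    filter_upwards [hφs, hfs, hR, hS, hn, hvanish, hall] with i hφi hfi hRi hSi hni hvi hCi z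
    by_cases hz : R + S < ‖z‖
    · rw [multiDeriv_eq_zero_of_lt_norm hvi α hz, abs_zero]
      positivity
    · have hα := contDiff_multiDeriv α hφi
      have hfn : Continuous fun y => f i (-y) := hfi.continuous.comp continuous_neg
      rw [multiDeriv_conv hφi hfn
        (hasCompactSupport_of_norm (R := S) fun x hx => hSi _ (by simpa using hx)),
        conv_neg_eq_integral]
      refine hni (fun y => multiDeriv α (φ i) (z + y)) _
        (hα.comp (contDiff_const.add contDiff_id)) (fun y hy => ?_) (fun β hβ x => ?_)
      · refine multiDeriv_eq_zero_of_lt_norm hRi α ?_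
        have h1 : ‖y‖ ≤ ‖z + y‖ + ‖z‖ := by simpa using norm_sub_le (z + y) z
        linarith [le_abs_self R, le_abs_self (R + S)]
      · rw [multiDeriv_comp_add_left β z hα, ← multiDeriv_add β α hφi]
        have hβs : β ∈ s := Finset.mem_Iic.2 fun j => hβ j
        exact ((hCi β hβs (z + x)).trans (le_abs_self _)).trans
          (Finset.single_le_sum (f := fun β => |C (α + β)|) (fun _ _ => abs_nonneg _) hβs)

end WeakSolution

end NSDist

theorem mainTheorem9 {ι : Type*} (U : Ultrafilter ι)
    (hU : ¬ CountableInterFilter (U : Filter ι)) {d : ℕ}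
    (P : MvPolynomial (Fin d) ℝ) (E f : NSDist.StarFun U d)
    (hE : NSDist.IsFundamentalSolution P E) (hf : NSDist.MemD' f)
    (hfc : NSDist.SCompactlySupported f) :
    NSDist.IsWeakSolution P f (NSDist.starConv E f) := by
  induction E using Quotient.inductionOn' with | h E => ?_
  induction f using Quotient.inductionOn' with | h f => ?_
  obtain ⟨hEs, -, hδ⟩ := hE
  have hEs' : ∀ᶠ i in (U : Filter ι), ContDiff ℝ ∞ (E i) := hEs
  have hfs : ∀ᶠ i in (U : Filter ι), ContDiff ℝ ∞ (f i) := hf.1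
  obtain ⟨S, hS⟩ := NSDist.SCompactlySupported.exists_norm hfc
  refine ⟨?_, NSDist.forall_star_iff.2 fun φ hφ => ?_⟩
  · refine NSDist.isStarSmooth_coe_iff (f := fun i => NSDist.conv (E i) (f i)) |>.2 ?_
    filter_upwards [hEs', hfs, hS] with i hEi hfi hSi
    exact NSDist.contDiff_conv hEi hfi.continuous (NSDist.hasCompactSupport_of_norm hSi)
  · obtain ⟨hφs, ⟨R, hR⟩, -⟩ := hφ.exists_bounds hU
    have h1 := NSDist.near_coe_iff.1 (hδ _ (NSDist.nearTestFunction_conv_neg hU hf hfc hφ))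
    refine NSDist.near_coe_iff.2 (h1.congr' ?_)
    filter_upwards [hEs', hfs, hS, hφs, hR] with i hEi hfi hSi hφi hRi
    have hfci := NSDist.hasCompactSupport_of_norm hSi
    -- The delta property tested on the correlation and the desired relation have exactly equal
    -- differences at almost every index.
    change (∫ x, NSDist.conv (φ i) (fun y => f i (-y)) x * NSDist.polyDiff P (E i) x) -
        NSDist.conv (φ i) (fun y => f i (-y)) 0 =
      (∫ x, NSDist.polyDiff P (NSDist.conv (E i) (f i)) x * φ i x) - ∫ x, f i x * φ i x
    rw [NSDist.polyDiff_conv P hEi hfi.continuous hfci,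
      NSDist.integral_conv_mul (NSDist.contDiff_polyDiff P hEi).continuous hfi.continuous
        hφi.continuous hfci (NSDist.hasCompactSupport_of_norm hRi),
      NSDist.conv_neg_eq_integral]
    simp only [zero_add]
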